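/- Algebraic spaces are understood as étale sheaves of sets on the category of schemes whose diagonal is representable by schemes and which admit an étale surjective morphism from a scheme; no separation condition is imposed. A morphism $f\colon S'\to S$ of algebraic spaces is called \emph{schematically dominant} if $\mathcal{O}_S\to f_*\mathcal{O}_{S'}$ is injective as a map of sheaves on the small étale site of $S$, and \emph{submersive} if $|f|\colon |S'|\to |S|$ is surjective and $|S|$ carries the quotient topology. Let $f\colon S'\to S$ be a morphism of algebraic spaces which is schematically dominant and such that, for every étale morphism of algebraic spaces $T\to S$, the base change $S'\times_S T\to T$ is submersive. Then $f$ is an epimorphism in the category of algebraic spaces, and for every étale morphism of algebraic spaces $T\to S$ the base change $S'\times_S T\to T$ is an epimorphism in the category of algebraic spaces. -/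

import Mathlib

universe u

open CategoryTheory Limits AlgebraicGeometry Opposite

namespace AlgebraicGeometry

/-- Presheaves of sets on the category of schemes. -/
abbrev SchPresheaf : Type (u + 1) := Scheme.{u}ᵒᵖ ⥤ Type u

/-- A presheaf on the category of schemes is an algebraic space if it is a sheaf for the étale
topology, its diagonal is representable (by schemes), and it receives an étale surjective
(representable) morphism from a scheme. No separation condition is imposed. -/
structure IsAlgebraicSpace (F : SchPresheaf.{u}) : Prop where
  isSheaf : Presheaf.IsSheaf Scheme.etaleTopology.{u} F
  representable_diag : yoneda.relativelyRepresentable (Limits.diag F)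
  exists_atlas : ∃ (U : Scheme.{u}) (a : yoneda.obj U ⟶ F),
    MorphismProperty.presheaf @Etale a ∧ MorphismProperty.presheaf @Surjective a

/-- The category of algebraic spaces, a full subcategory of presheaves on schemes. -/
abbrev AlgebraicSpace : Type (u + 1) :=
  ObjectProperty.FullSubcategory (C := SchPresheaf.{u}) IsAlgebraicSpace

namespace SchPresheaf

/-! ### The underlying topological space -/

/-- A field-valued point `Spec K ⟶ F`, given as an element of `F(Spec K)`. -/
structure FieldPoint (F : SchPresheaf.{u}) : Type (u + 1) where
  K : Type u
  [field : Field K]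
  pt : F.obj (op (Spec (CommRingCat.of K)))

attribute [instance] FieldPoint.field

/-- Two field-valued points are equivalent if they agree on some common field extension. -/
def FieldPoint.Rel {F : SchPresheaf.{u}} (x y : FieldPoint F) : Prop :=
  ∃ (Ω : Type u) (_ : Field Ω) (i : x.K →+* Ω) (j : y.K →+* Ω),
    F.map (Spec.map (CommRingCat.ofHom i)).op x.pt =
      F.map (Spec.map (CommRingCat.ofHom j)).op y.pt

/-- Two extensions of a field have a common extension. -/
theorem exists_common_extension {k K L : Type u} [Field k] [Field K] [Field L]
    (i : k →+* K) (j : k →+* L) :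
    ∃ (Ω : Type u) (_ : Field Ω) (a : K →+* Ω) (b : L →+* Ω), a.comp i = b.comp j := by
  let := i.toAlgebra
  let := j.toAlgebra
  obtain ⟨m, hm⟩ := Ideal.exists_maximal (TensorProduct k K L)
  let := Ideal.Quotient.field m
  refine ⟨TensorProduct k K L ⧸ m, inferInstance,
    (Ideal.Quotient.mk m).comp Algebra.TensorProduct.includeLeftRingHom,
    (Ideal.Quotient.mk m).comp
      (Algebra.TensorProduct.includeRight : L →ₐ[k] TensorProduct k K L).toRingHom, ?_⟩
  ext x
  exact congrArg (Ideal.Quotient.mk m)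
    (((Algebra.TensorProduct.includeLeft : K →ₐ[k] TensorProduct k K L).commutes x).trans
    ((Algebra.TensorProduct.includeRight : L →ₐ[k] TensorProduct k K L).commutes x).symm)

theorem map_map_spec (F : SchPresheaf.{u}) {k K L : Type u} [Field k] [Field K] [Field L]
    (i : k →+* K) (j : K →+* L) (x : F.obj (op (Spec (CommRingCat.of k)))) :
    F.map (Spec.map (CommRingCat.ofHom j)).op (F.map (Spec.map (CommRingCat.ofHom i)).op x) =
      F.map (Spec.map (CommRingCat.ofHom (j.comp i))).op x := by
  rw [CommRingCat.ofHom_comp, Spec.map_comp, op_comp, F.map_comp]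
  rfl

/-- The equivalence relation defining the points of a presheaf. -/
instance fieldPointSetoid (F : SchPresheaf.{u}) : Setoid (FieldPoint F) where
  r := FieldPoint.Rel
  iseqv :=
    { refl := fun x => ⟨x.K, inferInstance, RingHom.id _, RingHom.id _, rfl⟩
      symm := fun ⟨Ω, _, i, j, h⟩ => ⟨Ω, inferInstance, j, i, h.symm⟩
      trans := by
        rintro x y z ⟨Ω, _, i, j, h⟩ ⟨Ω', _, i', j', h'⟩
        obtain ⟨Ω'', _, a, b, hab⟩ := exists_common_extension j i'
        refine ⟨Ω'', inferInstance, a.comp i, b.comp j', ?_⟩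
        rw [← map_map_spec, h, map_map_spec, hab, ← map_map_spec, h', map_map_spec] }

/-- The set of points `|F|`: equivalence classes of field-valued points. -/
def Points (F : SchPresheaf.{u}) : Type (u + 1) := Quotient (fieldPointSetoid F)

/-- The image in `|F|` of a point `x` of a scheme `U` under `g : U ⟶ F`. -/
noncomputable def pointOf {F : SchPresheaf.{u}} {U : Scheme.{u}} (g : yoneda.obj U ⟶ F)
    (x : U) : F.Points :=
  Quotient.mk (fieldPointSetoid F)
    ⟨U.residueField x, g.app (op (Spec (U.residueField x))) (U.fromSpecResidueField x)⟩

/-- The topology on `|F|`: a set is open if its preimage in every scheme étale over `F` is. -/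
instance (F : SchPresheaf.{u}) : TopologicalSpace F.Points where
  IsOpen A := ∀ ⦃U : Scheme.{u}⦄ (g : yoneda.obj U ⟶ F),
    MorphismProperty.presheaf @Etale g → IsOpen (pointOf g ⁻¹' A)
  isOpen_univ := fun _ _ _ => isOpen_univ
  isOpen_inter := fun _ _ hA hB _ g hg => (hA g hg).inter (hB g hg)
  isOpen_sUnion := fun A hA U g hg => by
    rw [Set.preimage_sUnion]
    exact isOpen_biUnion fun B hB => hA B hB g hg

/-- The map `|F| → |G|` induced by a morphism `F ⟶ G`. -/
noncomputable def mapPoints {F G : SchPresheaf.{u}} (f : F ⟶ G) : F.Points → G.Points :=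
  Quotient.map (fun x => ⟨x.K, f.app _ x.pt⟩) (by
    rintro x y ⟨Ω, _, i, j, h⟩
    refine ⟨Ω, inferInstance, i, j, ?_⟩
    change G.map _ (f.app _ x.pt) = G.map _ (f.app _ y.pt)
    rw [← NatTrans.naturality_apply, ← NatTrans.naturality_apply, h])

/-- The presheaf `T ↦ Γ(T, 𝒪_T)` on schemes. Morphisms `F ⟶ structurePresheaf` are the
global functions on `F`. -/
noncomputable def structurePresheaf : SchPresheaf.{u} := Scheme.Γ ⋙ forget CommRingCat.{u}

end SchPresheaf

namespace AlgebraicSpace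

variable {X Y : AlgebraicSpace.{u}}

/-- A morphism `f : X ⟶ Y` of algebraic spaces (not necessarily representable) is étale if
for some étale surjective `U ⟶ X` from a scheme, the composite `U ⟶ Y` is étale. -/
def IsEtale (f : X ⟶ Y) : Prop :=
  ∃ (U : Scheme.{u}) (a : yoneda.obj U ⟶ X.obj),
    MorphismProperty.presheaf @Etale a ∧ MorphismProperty.presheaf @Surjective a ∧
    MorphismProperty.presheaf @Etale (a ≫ f.hom)

/-- A morphism of algebraic spaces is submersive if it is surjective on points and the target
carries the quotient topology. -/
def IsSubmersive (f : X ⟶ Y) : Prop :=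
  Topology.IsQuotientMap (SchPresheaf.mapPoints f.hom)

/-- A morphism `f : X ⟶ Y` of algebraic spaces is schematically dominant if `𝒪_Y ⟶ f_* 𝒪_X` is
injective on the small étale site of `Y`: for every scheme `U` étale over `Y`, pullback of
functions from `U` to `X ×_Y U` is injective. -/
def IsSchematicallyDominant (f : X ⟶ Y) : Prop :=
  ∀ ⦃U : Scheme.{u}⦄ (g : yoneda.obj U ⟶ Y.obj), MorphismProperty.presheaf @Etale g →
    Function.Injective
      (fun s : yoneda.obj U ⟶ SchPresheaf.structurePresheaf => pullback.snd f.hom g ≫ s)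

end AlgebraicSpace

end AlgebraicGeometry

/-! Let `T` be étale over `S`, and let `a`, `b` from `T` to `Z` agree on `S' ×_S T`. An étale atlas
`V` of `Z` gives the étale equivalence relation `R = V ×_Z V`. Lifting `a` and `b` to `R` produces a
scheme `Q`, étale over `T`, with maps `r₁ r₂ : Q ⟶ R`; where these coincide, so do `a` and `b`. Over
`S'`, the points `r₁ ≫ p₁` and `r₂ ≫ p₂` are related by some `ρ`, and `r₁ = r₂` exactly where both
equal `ρ`: an open condition, as the projections are étale. Submersiveness descends openness to `Q`
(`isOpen_of_forall_isTestPoint`), and schematic dominance gives `r₁ = r₂` on the resulting open `O`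
(`exists_opens_eq_coincidenceSet`). Surjectivity of base changes shows that `O` covers `T`, and the
sheaf property of `Z` concludes. -/

namespace AlgebraicGeometry

/-! ### Fibre products of algebraic spaces with schemes, and étale descent of equality. -/

namespace IsAlgebraicSpace

theorem presheaf_id_mem (P : MorphismProperty Scheme.{u}) [P.IsStableUnderBaseChange]
    (W : Scheme.{u}) (h : P (𝟙 W)) : P.presheaf (𝟙 (yoneda.obj W)) := by
  rw [← yoneda.map_id]
  exact MorphismProperty.relative_map h

/-- The functor of points of a scheme is an algebraic space. -/
theorem yoneda_obj (W : Scheme.{u}) : IsAlgebraicSpace (yoneda.obj W) where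
  isSheaf := by
    rw [isSheaf_iff_isSheaf_of_type]
    have : Scheme.etaleTopology.{u}.Subcanonical :=
      .of_le Scheme.etaleTopology_le_proetaleTopology
    exact GrothendieckTopology.Subcanonical.isSheaf_of_isRepresentable _
  representable_diag := by
    rw [Functor.relativelyRepresentable.diag_iff]
    intro a g
    obtain ⟨g, rfl⟩ := yoneda.map_surjective g
    exact .map yoneda g
  exists_atlas :=
    ⟨W, 𝟙 _, presheaf_id_mem @Etale W (inferInstanceAs (Etale (𝟙 W))),
      presheaf_id_mem @Surjective W (inferInstanceAs (Surjective (𝟙 W)))⟩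

/-- Morphisms from a scheme to a presheaf are relatively representable as soon as their
composites with a relatively representable morphism are. -/
theorem relativelyRepresentable_of_comp {F G : SchPresheaf.{u}} {p : F ⟶ G}
    (hp : yoneda.relativelyRepresentable p) {X : Scheme.{u}} (g : yoneda.obj X ⟶ F)
    (h : yoneda.relativelyRepresentable (g ≫ p)) : yoneda.relativelyRepresentable g := by
  -- Graph factorization: a section into the scheme `F ×_G X`, then the projection to `F`, a base
  -- change of `g ≫ p`.
  have e : g = yoneda.map (hp.lift g (𝟙 X) (by simp)) ≫ hp.fst (g ≫ p) := by simp
  rw [e]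
  exact MorphismProperty.comp_mem _ _ _ (.map yoneda _)
    (MorphismProperty.of_isPullback (hp.isPullback (g ≫ p)).flip h)

/-- The base change of an algebraic space along an étale morphism from a scheme is an algebraic
space. -/
theorem of_isPullback {P F G : SchPresheaf.{u}} {W : Scheme.{u}} {fst : P ⟶ F}
    {snd : P ⟶ yoneda.obj W} {f : F ⟶ G} {g : yoneda.obj W ⟶ G}
    (sq : IsPullback fst snd f g) (hF : IsAlgebraicSpace F) (hG : IsAlgebraicSpace G)
    (hg : yoneda.relativelyRepresentable g) : IsAlgebraicSpace P where
  isSheaf := by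
    have hW := (yoneda_obj W).isSheaf
    let c : cospan (C := Sheaf Scheme.etaleTopology.{u} (Type u))
        (X := ⟨F, hF.isSheaf⟩) (Y := ⟨yoneda.obj W, hW⟩) (Z := ⟨G, hG.isSheaf⟩) ⟨f⟩ ⟨g⟩ ⋙
        sheafToPresheaf _ _ ≅ cospan f g := cospanCompIso _ _ _
    exact Sheaf.isSheaf_of_isLimit _ _ ((IsLimit.postcomposeInvEquiv c _).symm sq.isLimit)
  representable_diag := by
    rw [Functor.relativelyRepresentable.diag_iff]
    intro a x
    exact relativelyRepresentable_of_comp (MorphismProperty.of_isPullback sq.flip hg) x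
      (Functor.relativelyRepresentable.diag_iff.1 hF.representable_diag _)
  exists_atlas := by
    obtain ⟨U, a, ha, ha'⟩ := hF.exists_atlas
    have hfst : yoneda.relativelyRepresentable fst := MorphismProperty.of_isPullback sq.flip hg
    refine ⟨_, hfst.fst a, ?_, ?_⟩
    · exact (MorphismProperty.relative_isStableUnderBaseChange _).of_isPullback
        (hfst.isPullback a).flip ha
    · exact (MorphismProperty.relative_isStableUnderBaseChange _).of_isPullback
        (hfst.isPullback a).flip ha'

end IsAlgebraicSpace

/-- A presheaf separated for the étale topology sees equality of morphisms after composition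
with an étale surjective morphism from a scheme. -/
theorem hom_ext_of_etale_surjective {F Z : SchPresheaf.{u}}
    (hZ : Presheaf.IsSheaf Scheme.etaleTopology.{u} Z)
    {O : Scheme.{u}} {c : yoneda.obj O ⟶ F} (hc : MorphismProperty.presheaf @Etale c)
    (hc' : MorphismProperty.presheaf @Surjective c) {a b : F ⟶ Z} (h : c ≫ a = c ≫ b) : a = b := by
  refine hom_ext_yoneda fun X x ↦ ?_
  have het : Etale (hc.rep.snd x) := hc.property_snd x
  have hsurj : Surjective (hc.rep.snd x) := hc'.property _ _ _ (hc.rep.isPullback x)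
  have hmem : Presieve.singleton (hc.rep.snd x) ∈ Scheme.precoverage @Etale X :=
    (Scheme.singleton_mem_precoverage_iff _ _).2 ⟨hsurj.surj, het⟩
  have hs := (((isSheaf_iff_isSheaf_of_type _ _).1 hZ).isSheafFor_of_mem_precoverage
    hmem).isSeparatedFor
  apply yonedaEquiv.injective
  refine hs.ext ?_
  rintro Y _ ⟨⟩
  have : yoneda.map (hc.rep.snd x) ≫ x ≫ a = yoneda.map (hc.rep.snd x) ≫ x ≫ b := by
    rw [← hc.rep.w_assoc, ← hc.rep.w_assoc, h]
  simpa [yonedaEquiv_naturality] using congrArg yonedaEquiv this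

end AlgebraicGeometry

/-! ### Coincidence loci of maps to an étale equivalence relation. -/

namespace AlgebraicGeometry

theorem exists_spec_field_mem_range {X : Scheme.{u}} (x : X) :
    ∃ (K : Type u) (_ : Field K) (y : Spec (.of K) ⟶ X), x ∈ Set.range y :=
  ⟨X.residueField x, inferInstance, X.fromSpecResidueField x, by
    rw [Scheme.range_fromSpecResidueField]; rfl⟩

/-- Two morphisms to an étale `V`-scheme that agree over `V` agree on an open subscheme containing
every field-valued point at which they agree. -/
theorem exists_opens_eq_on {X R V : Scheme.{u}} (p : R ⟶ V) [Etale p] (r s : X ⟶ R)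
    (h : r ≫ p = s ≫ p) :
    ∃ E : X.Opens, E.ι ≫ r = E.ι ≫ s ∧
      ∀ (K : Type u) [Field K] (y : Spec (.of K) ⟶ X), y ≫ r = y ≫ s →
        ∀ z, y z ∈ E := by
  obtain ⟨l, hl₁, hl₂⟩ : ∃ l : X ⟶ pullback p p,
      l ≫ pullback.fst p p = r ∧ l ≫ pullback.snd p p = s :=
    ⟨pullback.lift r s h, pullback.lift_fst _ _ _, pullback.lift_snd _ _ _⟩
  -- The diagonal of an étale morphism is an open immersion.
  let E : X.Opens := l ⁻¹ᵁ (pullback.diagonal p).opensRange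
  refine ⟨E, ?_, fun K _ y hy z ↦ ?_⟩
  · let m := IsOpenImmersion.lift (pullback.diagonal p) (E.ι ≫ l) (by
      rintro _ ⟨x, rfl⟩
      rw [← Scheme.Hom.coe_opensRange, Scheme.Hom.comp_apply]
      exact x.2)
    have hm : m ≫ pullback.diagonal p = E.ι ≫ l := IsOpenImmersion.lift_fac _ _ _
    have h1 := congrArg (· ≫ pullback.fst p p) hm
    have h2 := congrArg (· ≫ pullback.snd p p) hm
    simp only [Category.assoc, pullback.diagonal_fst, pullback.diagonal_snd, hl₁, hl₂] at h1 h2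
    rw [← h1, h2]
  · have : y ≫ l = (y ≫ r) ≫ pullback.diagonal p := by
      apply pullback.hom_ext <;> simp [hl₁, hl₂, hy]
    change l (y z) ∈ Set.range (pullback.diagonal p)
    rw [← Scheme.Hom.comp_apply, this, Scheme.Hom.comp_apply]
    exact ⟨_, rfl⟩

/-- The set of points of `Q` over which some field-valued point equalizes `r` and `s`. -/
def coincidenceSet {Q R : Scheme.{u}} (r s : Q ⟶ R) : Set Q :=
  {q | ∃ (K : Type u) (_ : Field K) (y : Spec (.of K) ⟶ Q), y ≫ r = y ≫ s ∧ q ∈ Set.range y}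

theorem apply_eq_of_mem_coincidenceSet {Q R : Scheme.{u}} {r s : Q ⟶ R} {q : Q}
    (hq : q ∈ coincidenceSet r s) : r q = s q := by
  obtain ⟨K, _, y, hy, z, rfl⟩ := hq
  rw [← Scheme.Hom.comp_apply, hy, Scheme.Hom.comp_apply]

section

variable {Q R V X : Scheme.{u}} {p₁ p₂ : R ⟶ V} [Etale p₁] [Etale p₂]
  {r₁ r₂ : Q ⟶ R} {h : X ⟶ Q} {ρ : X ⟶ R}

/-- A point lying over a coincidence point of `r₁` and `r₂` underlies a field-valued point at which
the pullbacks of `r₁` and `r₂` agree. -/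
theorem exists_spec_of_apply_mem_coincidenceSet {x : X} (hx : h x ∈ coincidenceSet r₁ r₂) :
    ∃ (Ω : Type u) (_ : Field Ω) (y : Spec (.of Ω) ⟶ X),
      x ∈ Set.range y ∧ y ≫ h ≫ r₁ = y ≫ h ≫ r₂ := by
  obtain ⟨K, _, y, hy, z, hz⟩ := hx
  obtain ⟨w, hw₁, hw₂⟩ := Scheme.Pullback.exists_preimage_pullback x z hz.symm
  obtain ⟨Ω, _, y', v, rfl⟩ := exists_spec_field_mem_range w
  refine ⟨Ω, inferInstance, y' ≫ pullback.fst h y, ⟨v, ?_⟩, ?_⟩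
  · rw [Scheme.Hom.comp_apply, hw₁]
  · simp only [Category.assoc]
    rw [pullback.condition_assoc, pullback.condition_assoc, hy]

variable (hp : ∀ {Y : Scheme.{u}} (u v : Y ⟶ R), u ≫ p₁ = v ≫ p₁ → u ≫ p₂ = v ≫ p₂ → u = v)
  (h₁ : h ≫ r₁ ≫ p₁ = ρ ≫ p₁) (h₂ : h ≫ r₂ ≫ p₂ = ρ ≫ p₂)
include hp h₁ h₂

/-- At a field-valued point where `r₁` and `r₂` agree, their common value has both projections of
`ρ`, so equals `ρ` by `hp`. The set is thus the intersection of the loci `h ≫ r₁ = ρ` and `h ≫ r₂ =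
ρ`, open because `p₁` and `p₂` are étale. -/
theorem exists_opens_eq_preimage_coincidenceSet :
    ∃ E : X.Opens, (E : Set X) = h ⁻¹' coincidenceSet r₁ r₂ ∧ E.ι ≫ h ≫ r₁ = E.ι ≫ h ≫ r₂ := by
  obtain ⟨E₁, he₁, hE₁⟩ := exists_opens_eq_on p₁ (h ≫ r₁) ρ (by simpa using h₁)
  obtain ⟨E₂, he₂, hE₂⟩ := exists_opens_eq_on p₂ (h ≫ r₂) ρ (by simpa using h₂)
  have key : (E₁ ⊓ E₂).ι ≫ h ≫ r₁ = (E₁ ⊓ E₂).ι ≫ h ≫ r₂ := by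
    have e₁ := congrArg (X.homOfLE (inf_le_left : E₁ ⊓ E₂ ≤ E₁) ≫ ·) he₁
    have e₂ := congrArg (X.homOfLE (inf_le_right : E₁ ⊓ E₂ ≤ E₂) ≫ ·) he₂
    simp only [Scheme.homOfLE_ι_assoc] at e₁ e₂
    exact e₁.trans e₂.symm
  refine ⟨E₁ ⊓ E₂, Set.Subset.antisymm (fun x hx ↦ ?_) fun x hx ↦ ?_, key⟩
  · obtain ⟨K, _, y, v, hv⟩ := exists_spec_field_mem_range (X := (E₁ ⊓ E₂ : X.Opens)) ⟨x, hx⟩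
    refine ⟨K, inferInstance, y ≫ (E₁ ⊓ E₂).ι ≫ h, ?_, v, ?_⟩
    · simp only [Category.assoc]
      rw [key]
    · simp only [Scheme.Hom.comp_apply, hv]
      rfl
  · obtain ⟨Ω, _, y, ⟨z, rfl⟩, hy⟩ := exists_spec_of_apply_mem_coincidenceSet hx
    have hρ : y ≫ h ≫ r₁ = y ≫ ρ := hp _ _ (by simp [h₁]) (by simp [hy, h₂])
    exact ⟨hE₁ _ y hρ z, hE₂ _ y (hy.symm.trans hρ) z⟩

theorem isOpen_preimage_coincidenceSet : IsOpen (h ⁻¹' coincidenceSet r₁ r₂) := by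
  obtain ⟨E, hE, -⟩ := exists_opens_eq_preimage_coincidenceSet hp h₁ h₂
  exact hE ▸ E.2

theorem comp_eq_comp_of_forall_mem_coincidenceSet (hx : ∀ x, h x ∈ coincidenceSet r₁ r₂) :
    h ≫ r₁ = h ≫ r₂ := by
  obtain ⟨E, hE, he⟩ := exists_opens_eq_preimage_coincidenceSet hp h₁ h₂
  obtain rfl : E = ⊤ := by
    ext x
    simpa [hE] using hx x
  rwa [← Scheme.topIso_hom, cancel_epi] at he

end

end AlgebraicGeometry

/-! ### Submersiveness and dominance expressed through scheme-valued test points. -/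

namespace AlgebraicGeometry

theorem presheaf_etale_comp {F G H : SchPresheaf.{u}} {f : F ⟶ G} {g : G ⟶ H}
    (hf : MorphismProperty.presheaf @Etale f) (hg : MorphismProperty.presheaf @Etale g) :
    MorphismProperty.presheaf @Etale (f ≫ g) :=
  have : MorphismProperty.IsStableUnderComposition (@Etale.{u}) :=
    Etale.instIsMultiplicativeScheme.toIsStableUnderComposition
  (MorphismProperty.relative_isStableUnderComposition (F := yoneda) _).comp_mem f g hf hg

theorem presheaf_surjective_comp {F G H : SchPresheaf.{u}} {f : F ⟶ G} {g : G ⟶ H}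
    (hf : MorphismProperty.presheaf @Surjective f)
    (hg : MorphismProperty.presheaf @Surjective g) :
    MorphismProperty.presheaf @Surjective (f ≫ g) :=
  have : MorphismProperty.IsStableUnderComposition (@Surjective.{u}) :=
    ⟨fun f g (_ : Surjective f) (_ : Surjective g) ↦ inferInstanceAs (Surjective (f ≫ g))⟩
  (MorphismProperty.relative_isStableUnderComposition (F := yoneda) _).comp_mem f g hf hg

theorem presheaf_etale_map {X Y : Scheme.{u}} (f : X ⟶ Y) [h : Etale f] :
    MorphismProperty.presheaf @Etale (yoneda.map f) :=
  MorphismProperty.relative_map h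

theorem presheaf_surjective_map {X Y : Scheme.{u}} (f : X ⟶ Y) [h : Surjective f] :
    MorphismProperty.presheaf @Surjective (yoneda.map f) :=
  MorphismProperty.relative_map h

namespace SchPresheaf

/-- The morphism of schemes given by a field-valued point of the functor of points. -/
def FieldPoint.toHom {W : Scheme.{u}} (q : FieldPoint (yoneda.obj W)) : Spec (.of q.K) ⟶ W :=
  q.pt

/-- Spectra of fields are single points, so a field extension does not change the image. -/
theorem range_eq_of_rel {W : Scheme.{u}} {p q : FieldPoint (yoneda.obj W)} (h : p.Rel q) :
    Set.range p.toHom =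
      Set.range q.toHom := by
  obtain ⟨Ω, _, i, j, h⟩ := h
  have key : ∀ {K : Type u} [Field K] (i : K →+* Ω) (y : Spec (.of K) ⟶ W),
      Set.range (Spec.map (CommRingCat.ofHom i) ≫ y) = Set.range y := by
    intro K _ i y
    have : Surjective (Spec.map (CommRingCat.ofHom i)) := by
      refine ⟨fun x ↦ ⟨(inferInstance : Nonempty (PrimeSpectrum Ω)).some, ?_⟩⟩
      exact (inferInstance : Subsingleton (PrimeSpectrum K)).elim _ _
    rw [Scheme.Hom.comp_base, TopCat.coe_comp,
      (Spec.map (CommRingCat.ofHom i)).surjective.range_comp]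
  rw [← key i, ← key j]
  exact congrArg (fun y : Spec (.of Ω) ⟶ W ↦ Set.range y) h

theorem range_eq_of_pointOf_eq {W P : Scheme.{u}} {h : P ⟶ W} {x : P}
    {q : FieldPoint (yoneda.obj W)} (e : pointOf (yoneda.map h) x = Quotient.mk _ q) :
    Set.range q.toHom = {h x} := by
  rw [← range_eq_of_rel (Quotient.exact e)]
  change Set.range (P.fromSpecResidueField x ≫ h) = _
  rw [Scheme.Hom.comp_base, TopCat.coe_comp, Set.range_comp, Scheme.range_fromSpecResidueField,
    Set.image_singleton]

/-- The morphism to the structure presheaf given by a global section. -/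
noncomputable def ofSection {W : Scheme.{u}} (s : Γ(W, ⊤)) :
    yoneda.obj W ⟶ structurePresheaf.{u} :=
  yonedaEquiv.symm s

theorem ofSection_injective {W : Scheme.{u}} : Function.Injective (ofSection (W := W)) :=
  (yonedaEquiv (X := W) (F := structurePresheaf.{u})).symm.injective

theorem map_comp_ofSection {X W : Scheme.{u}} (k : X ⟶ W) (s : Γ(W, ⊤)) :
    yoneda.map k ≫ ofSection s = ofSection (k.appTop s) :=
  yonedaEquiv_symm_naturality_left k structurePresheaf s

end SchPresheaf

open SchPresheaf

section

variable {S' S : AlgebraicSpace.{u}} {f : S' ⟶ S} {W : Scheme.{u}} {w : yoneda.obj W ⟶ S.obj}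

/-- The morphism `h : X ⟶ W` lifts to an `X`-valued point of `S' ×_S W`. -/
def IsTestPoint (f : S' ⟶ S) (w : yoneda.obj W ⟶ S.obj) {X : Scheme.{u}} (h : X ⟶ W) : Prop :=
  ∃ s' : yoneda.obj X ⟶ S'.obj, s' ≫ f.hom = yoneda.map h ≫ w

theorem exists_isPullback_scheme (f : S' ⟶ S) (hw : MorphismProperty.presheaf @Etale w) :
    ∃ (T' : AlgebraicSpace.{u}) (g' : T' ⟶ S') (f' : T' ⟶ ⟨_, IsAlgebraicSpace.yoneda_obj W⟩),
      IsPullback g' f' f (ObjectProperty.homMk w) := by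
  have sq := IsPullback.of_hasPullback f.hom w
  refine ⟨⟨_, IsAlgebraicSpace.of_isPullback sq S'.property S.property hw.rep⟩,
    ObjectProperty.homMk (pullback.fst _ _), ObjectProperty.homMk (pullback.snd _ _), ?_⟩
  exact IsPullback.of_map (ObjectProperty.ι _) (by ext1; exact sq.w) sq

theorem isEtale_homMk (hw : MorphismProperty.presheaf @Etale w) :
    AlgebraicSpace.IsEtale (X := ⟨_, IsAlgebraicSpace.yoneda_obj W⟩) (ObjectProperty.homMk w) :=
  ⟨W, 𝟙 _, IsAlgebraicSpace.presheaf_id_mem @Etale W (inferInstanceAs (Etale (𝟙 W))),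
    IsAlgebraicSpace.presheaf_id_mem @Surjective W (inferInstanceAs (Surjective (𝟙 W))),
    by simpa using hw⟩

section

variable (hsub : ∀ ⦃T' T : AlgebraicSpace.{u}⦄ (g : T ⟶ S) (g' : T' ⟶ S') (f' : T' ⟶ T),
      AlgebraicSpace.IsEtale g → IsPullback g' f' f g → AlgebraicSpace.IsSubmersive f')
  (hw : MorphismProperty.presheaf @Etale w)
include hsub hw

theorem exists_isTestPoint_spec (x : W) :
    ∃ (K : Type u) (_ : Field K) (y : Spec (.of K) ⟶ W), x ∈ Set.range y ∧ IsTestPoint f w y := by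
  obtain ⟨T', g', f', sq⟩ := exists_isPullback_scheme f hw
  have hq := hsub _ _ _ (isEtale_homMk hw) sq
  obtain ⟨t, ht⟩ := hq.surjective (pointOf (yoneda.map (𝟙 W)) x)
  obtain ⟨t, rfl⟩ := Quotient.exists_rep t
  let τ : yoneda.obj (Spec (.of t.K)) ⟶ T'.obj := yonedaEquiv.symm t.pt
  obtain ⟨y, hy⟩ := yoneda.map_surjective (τ ≫ f'.hom)
  refine ⟨t.K, inferInstance, y, ?_, τ ≫ g'.hom, ?_⟩
  · have hr := range_eq_of_pointOf_eq ht.symm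
    have e : y = f'.hom.app (op (Spec (.of t.K))) t.pt := by
      have := congrArg yonedaEquiv hy
      rw [yonedaEquiv_comp, Equiv.apply_symm_apply] at this
      rw [← this, yonedaEquiv_yoneda_map]
    exact e ▸ (hr ▸ rfl : x ∈ _)
  · rw [hy, Category.assoc, Category.assoc]
    exact congrArg (τ ≫ ·.hom) sq.w

theorem isOpen_of_forall_isTestPoint (A : Set W)
    (hA : ∀ {P : Scheme.{u}} (h : P ⟶ W), IsTestPoint f w h → IsOpen (h ⁻¹' A)) : IsOpen A := by
  obtain ⟨T', g', f', sq⟩ := exists_isPullback_scheme f hw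
  have hq := hsub _ _ _ (isEtale_homMk hw) sq
  -- `A` transported to classes of field-valued points; quantifying over all representatives avoids
  -- a choice.
  let A' : Set (SchPresheaf.Points (yoneda.obj W)) := {p | ∀ q : FieldPoint (yoneda.obj W),
    p = Quotient.mk _ q → Set.range q.toHom ⊆ A}
  have hA' : ∀ {P : Scheme.{u}} (h : P ⟶ W), pointOf (yoneda.map h) ⁻¹' A' = h ⁻¹' A := by
    intro P h
    ext x
    refine ⟨fun hx ↦ ?_, fun hx q hxq ↦ ?_⟩
    · have := hx _ rfl
      rw [range_eq_of_pointOf_eq rfl] at this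
      exact this rfl
    · rw [range_eq_of_pointOf_eq hxq]
      exact Set.singleton_subset_iff.2 hx
  have hopen : IsOpen A' := by
    refine hq.isOpen_preimage.1 fun P g hg ↦ ?_
    obtain ⟨h, hh⟩ := yoneda.map_surjective (g ≫ f'.hom)
    have : pointOf g ⁻¹' (mapPoints f'.hom ⁻¹' A') = h ⁻¹' A := by
      rw [← hA' h, hh]
      rfl
    rw [this]
    exact hA h ⟨g ≫ g'.hom, by
      rw [hh, Category.assoc, Category.assoc]
      exact congrArg (g ≫ ·.hom) sq.w⟩
  have := hopen (yoneda.map (𝟙 W)) (presheaf_etale_map _)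
  rwa [hA'] at this

end

/-- Maps to an affine scheme are determined by pullback of global functions, and dominance detects
functions on `W` after base change to `S'`. -/
theorem eq_of_forall_isTestPoint (hdom : AlgebraicSpace.IsSchematicallyDominant f)
    (hw : MorphismProperty.presheaf @Etale w) {N : Scheme.{u}} [IsAffine N] (r₁ r₂ : W ⟶ N)
    (h : ∀ {X : Scheme.{u}} (h : X ⟶ W), IsTestPoint f w h → h ≫ r₁ = h ≫ r₂) : r₁ = r₂ := by
  apply ext_of_isAffine
  ext n
  refine ofSection_injective (hdom w hw ?_)
  · refine hom_ext_yoneda fun X x ↦ ?_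
    obtain ⟨k, hk⟩ := yoneda.map_surjective (x ≫ pullback.snd f.hom w)
    have e := h k ⟨x ≫ pullback.fst _ _, by rw [hk, Category.assoc, pullback.condition,
      Category.assoc]⟩
    rw [← Category.assoc, ← Category.assoc, ← hk, map_comp_ofSection, map_comp_ofSection]
    congr 1
    have := congrArg (fun φ ↦ φ.appTop n) e
    simp only [Scheme.Hom.comp_appTop] at this
    exact this

end

end AlgebraicGeometry

/-! ### Descent of equality from `S'` and the epimorphism statement. -/

namespace AlgebraicGeometry

section

variable {S' S : AlgebraicSpace.{u}} {f : S' ⟶ S}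
  (hdom : AlgebraicSpace.IsSchematicallyDominant f)
  (hsub : ∀ ⦃T' T : AlgebraicSpace.{u}⦄ (g : T ⟶ S) (g' : T' ⟶ S') (f' : T' ⟶ T),
      AlgebraicSpace.IsEtale g → IsPullback g' f' f g → AlgebraicSpace.IsSubmersive f')
include hdom hsub

/-- Two morphisms to an étale equivalence relation whose outer projections become related over
`S' ×_S Q` agree on an open subscheme supported on their coincidence set. -/
theorem exists_opens_eq_coincidenceSet {Q R V : Scheme.{u}} {w : yoneda.obj Q ⟶ S.obj}
    (hw : MorphismProperty.presheaf @Etale w) {p₁ p₂ : R ⟶ V} [Etale p₁] [Etale p₂]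
    (hp : ∀ {Y : Scheme.{u}} (u v : Y ⟶ R), u ≫ p₁ = v ≫ p₁ → u ≫ p₂ = v ≫ p₂ → u = v)
    (r₁ r₂ : Q ⟶ R)
    (hρ : ∀ {X : Scheme.{u}} (h : X ⟶ Q), IsTestPoint f w h →
      ∃ ρ : X ⟶ R, h ≫ r₁ ≫ p₁ = ρ ≫ p₁ ∧ h ≫ r₂ ≫ p₂ = ρ ≫ p₂) :
    ∃ O : Q.Opens, (O : Set Q) = coincidenceSet r₁ r₂ ∧ O.ι ≫ r₁ = O.ι ≫ r₂ := by
  have hopen : IsOpen (coincidenceSet r₁ r₂) := by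
    refine isOpen_of_forall_isTestPoint hsub hw _ fun h hh ↦ ?_
    obtain ⟨ρ, h₁, h₂⟩ := hρ h hh
    exact isOpen_preimage_coincidenceSet hp h₁ h₂
  let O : Q.Opens := ⟨coincidenceSet r₁ r₂, hopen⟩
  refine ⟨O, rfl, ?_⟩
  have hloc : ∀ x : O, ∃ B : Q.Opens, x.1 ∈ B ∧ B.ι ≫ r₁ = B.ι ≫ r₂ := by
    intro x
    obtain ⟨N, hN, hxN, -⟩ := exists_isAffineOpen_mem_and_subset (x := r₁ x.1) (U := ⊤) trivial
    -- At a coincidence point both maps have the same image, so both land in the affine `N` nearby.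
    let B : Q.Opens := O ⊓ (r₁ ⁻¹ᵁ N ⊓ r₂ ⁻¹ᵁ N)
    have hB₁ : B ≤ r₁ ⁻¹ᵁ N := inf_le_right.trans inf_le_left
    have hB₂ : B ≤ r₂ ⁻¹ᵁ N := inf_le_right.trans inf_le_right
    have hxN' : r₂ x.1 ∈ N := apply_eq_of_mem_coincidenceSet x.2 ▸ hxN
    refine ⟨B, ⟨x.2, hxN, hxN'⟩, ?_⟩
    have : IsAffine N := hN
    rw [← Scheme.Hom.resLE_comp_ι r₁ hB₁, ← Scheme.Hom.resLE_comp_ι r₂ hB₂]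
    congr 1
    refine eq_of_forall_isTestPoint hdom (presheaf_etale_comp (presheaf_etale_map B.ι) hw) _ _
      fun {X} h ⟨s', hs'⟩ ↦ ?_
    obtain ⟨ρ, h₁, h₂⟩ := hρ (h ≫ B.ι) ⟨s', by simpa using hs'⟩
    have key := comp_eq_comp_of_forall_mem_coincidenceSet hp h₁ h₂ fun z ↦ by
      rw [Scheme.Hom.comp_apply]
      exact (h z).2.1
    rw [← cancel_mono N.ι]
    simpa using key
  choose B hxB hB using hloc
  let 𝒰 : (O : Scheme.{u}).OpenCover := Scheme.openCoverOfIsOpenCover _ (fun x ↦ O.ι ⁻¹ᵁ B x)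
    (.mk (eq_top_iff.2 fun x _ ↦ TopologicalSpace.Opens.mem_iSup.2 ⟨x, hxB x⟩))
  have h𝒰 (x : O) : (O.ι ⁻¹ᵁ B x).ι ≫ O.ι ≫ r₁ = (O.ι ⁻¹ᵁ B x).ι ≫ O.ι ≫ r₂ := by
    have e : (O.ι ⁻¹ᵁ B x).ι ≫ O.ι = (O.ι ∣_ B x) ≫ (B x).ι := (morphismRestrict_ι _ _).symm
    rw [reassoc_of% e, hB, ← reassoc_of% e]
  exact Scheme.Cover.hom_ext 𝒰 _ _ h𝒰

/-- Morphisms from a presheaf étale over `S` to an algebraic space are equal if they agree on the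
base change to `S'`. -/
theorem hom_ext_of_submersive {T Z : SchPresheaf.{u}} (hZ : IsAlgebraicSpace Z) {g : T ⟶ S.obj}
    {U : Scheme.{u}} {α : yoneda.obj U ⟶ T} (hα : MorphismProperty.presheaf @Etale α)
    (hα' : MorphismProperty.presheaf @Surjective α)
    (hαg : MorphismProperty.presheaf @Etale (α ≫ g)) {a b : T ⟶ Z}
    (hab : ∀ {X : Scheme.{u}} (s' : yoneda.obj X ⟶ S'.obj) (x : yoneda.obj X ⟶ T),
      s' ≫ f.hom = x ≫ g → x ≫ a = x ≫ b) : a = b := by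
  obtain ⟨V, v, hv, hv'⟩ := hZ.exists_atlas
  obtain ⟨R, p₁, p₂, sqR⟩ : ∃ (R : Scheme.{u}) (p₁ p₂ : R ⟶ V),
      IsPullback (yoneda.map p₁) (yoneda.map p₂) v v := ⟨_, _, _, hv.rep.isPullback' v⟩
  have : Etale p₁ := hv.property _ _ _ sqR.flip
  have : Etale p₂ := hv.property _ _ _ sqR
  have hR : ∀ {Y : Scheme.{u}} (y z : Y ⟶ V), yoneda.map y ≫ v = yoneda.map z ≫ v →
      ∃ ρ : Y ⟶ R, ρ ≫ p₁ = y ∧ ρ ≫ p₂ = z := by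
    intro Y y z h
    obtain ⟨ρ, hρ⟩ := yoneda.map_surjective (sqR.lift _ _ h)
    refine ⟨ρ, yoneda.map_injective ?_, yoneda.map_injective ?_⟩ <;> simp [hρ]
  have hp : ∀ {Y : Scheme.{u}} (y z : Y ⟶ R), y ≫ p₁ = z ≫ p₁ → y ≫ p₂ = z ≫ p₂ → y = z := by
    intro Y y z h₁ h₂
    refine yoneda.map_injective (sqR.hom_ext ?_ ?_) <;> simp only [← Functor.map_comp, h₁, h₂]
  have hc := presheaf_etale_comp (presheaf_etale_map p₁) hv
  -- `Q` parametrizes triples `(ρ₁, r₂, u)` with `ρ₁` over `a (α u)` and `r₂` over `b (α u)` in `Z`.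
  obtain ⟨Q₁, ρ₁, q₁, sq₁⟩ : ∃ (Q₁ : Scheme.{u}) (ρ₁ : Q₁ ⟶ R) (q₁ : Q₁ ⟶ U),
      IsPullback (yoneda.map ρ₁) (yoneda.map q₁) (yoneda.map p₁ ≫ v) (α ≫ a) :=
    ⟨_, _, _, hc.rep.isPullback' _⟩
  have : Etale q₁ := hc.property _ _ _ sq₁
  obtain ⟨Q, r₂, q₂, sq₂⟩ : ∃ (Q : Scheme.{u}) (r₂ : Q ⟶ R) (q₂ : Q ⟶ Q₁),
      IsPullback (yoneda.map r₂) (yoneda.map q₂) (yoneda.map p₁ ≫ v)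
        (yoneda.map q₁ ≫ α ≫ b) :=
    ⟨_, _, _, hc.rep.isPullback' _⟩
  have : Etale q₂ := hc.property _ _ _ sq₂
  obtain ⟨t, ht⟩ : ∃ t, t = yoneda.map (q₂ ≫ q₁) ≫ α := ⟨_, rfl⟩
  have hta : t ≫ a = yoneda.map ((q₂ ≫ ρ₁) ≫ p₁) ≫ v := by
    simp [ht, sq₁.w]
  -- `a` is lifted through `p₁` but `b` through `p₂`, matching the two ends of the relation `ρ`.
  have htb : t ≫ b = yoneda.map (r₂ ≫ p₂) ≫ v := by
    simp [ht, ← sq₂.w, sqR.w]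
  have htg : MorphismProperty.presheaf @Etale (t ≫ g) := by
    rw [ht, Category.assoc]
    exact presheaf_etale_comp (presheaf_etale_map _) hαg
  obtain ⟨O, hO, hOr⟩ := exists_opens_eq_coincidenceSet hdom hsub htg hp (q₂ ≫ ρ₁) r₂
    fun {X} h ⟨s', hs'⟩ ↦ by
      have e := hab s' (yoneda.map h ≫ t) (by simpa using hs')
      rw [Category.assoc, Category.assoc, hta, htb, ← Category.assoc, ← Category.assoc,
        ← Functor.map_comp, ← Functor.map_comp] at e
      obtain ⟨ρ, hρ₁, hρ₂⟩ := hR _ _ e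
      exact ⟨ρ, by simp [hρ₁], by simp [hρ₂]⟩
  -- Over a field-valued point coming from `S'`, `a` and `b` agree; after an extension their common
  -- value lifts to `V`. Its diagonal point `δ` of `R`, used for both lifts, gives a point of `O`.
  have hsurj : Surjective (O.ι ≫ q₂ ≫ q₁) := by
    refine ⟨fun x ↦ ?_⟩
    obtain ⟨K, _, y, ⟨z, rfl⟩, s', hs'⟩ := exists_isTestPoint_spec hsub hαg x
    have e := hab s' (yoneda.map y ≫ α) (by simpa using hs')
    obtain ⟨M, k, m, sqM⟩ : ∃ (M : Scheme.{u}) (k : M ⟶ V) (m : M ⟶ Spec (.of K)),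
        IsPullback (yoneda.map k) (yoneda.map m) v ((yoneda.map y ≫ α) ≫ a) :=
      ⟨_, _, _, hv.rep.isPullback' _⟩
    have : Surjective m := hv'.property _ _ _ sqM
    obtain ⟨z', rfl⟩ := m.surjective z
    obtain ⟨Ω, _, y', z'', rfl⟩ := exists_spec_field_mem_range z'
    obtain ⟨δ, hδ, -⟩ := hR (y' ≫ k) (y' ≫ k) rfl
    have hδv : yoneda.map δ ≫ yoneda.map p₁ ≫ v =
        yoneda.map (y' ≫ m ≫ y) ≫ α ≫ a := by
      rw [← Category.assoc, ← Functor.map_comp, hδ]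
      simp [sqM.w]
    obtain ⟨l₁, hl₁⟩ := yoneda.map_surjective (sq₁.lift _ _ hδv)
    have h₁ : l₁ ≫ ρ₁ = δ := yoneda.map_injective (by simp [hl₁])
    have h₂ : l₁ ≫ q₁ = y' ≫ m ≫ y := yoneda.map_injective (by simp [hl₁])
    obtain ⟨l, hl⟩ := yoneda.map_surjective (sq₂.lift (yoneda.map δ) (yoneda.map l₁) (by
      rw [hδv, ← Category.assoc (yoneda.map l₁), ← Functor.map_comp, h₂]
      simpa using congrArg (yoneda.map (y' ≫ m) ≫ ·) e))
    have h₃ : l ≫ r₂ = δ := yoneda.map_injective (by simp [hl])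
    have h₄ : l ≫ q₂ = l₁ := yoneda.map_injective (by simp [hl])
    have hmem : l z'' ∈ O := by
      rw [← SetLike.mem_coe, hO]
      exact ⟨Ω, inferInstance, l, by rw [reassoc_of% h₄, h₁, h₃], z'', rfl⟩
    refine ⟨⟨l z'', hmem⟩, ?_⟩
    change (q₂ ≫ q₁) (l z'') = _
    rw [← Scheme.Hom.comp_apply, reassoc_of% h₄, h₂]
    simp
  refine hom_ext_of_etale_surjective hZ.isSheaf
    (presheaf_etale_comp (presheaf_etale_map (O.ι ≫ q₂ ≫ q₁)) hα)
    (presheaf_surjective_comp (presheaf_surjective_map (O.ι ≫ q₂ ≫ q₁)) hα') ?_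
  have e : yoneda.map (O.ι ≫ q₂ ≫ q₁) ≫ α = yoneda.map O.ι ≫ t := by simp [ht]
  rw [e, Category.assoc, Category.assoc, hta, htb, ← Category.assoc, ← Category.assoc,
    ← Functor.map_comp, ← Functor.map_comp, ← Category.assoc, hOr, Functor.map_comp,
    Category.assoc, ← Category.assoc O.ι, Functor.map_comp, Category.assoc, sqR.w]
  simp

end

end AlgebraicGeometry

theorem mainTheorem11 {S' S : AlgebraicSpace.{u}} (f : S' ⟶ S)
    (hdom : AlgebraicSpace.IsSchematicallyDominant f)
    (hsub : ∀ ⦃T' T : AlgebraicSpace.{u}⦄ (g : T ⟶ S) (g' : T' ⟶ S') (f' : T' ⟶ T),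
      AlgebraicSpace.IsEtale g → IsPullback g' f' f g → AlgebraicSpace.IsSubmersive f') :
    Epi f ∧
      ∀ ⦃T' T : AlgebraicSpace.{u}⦄ (g : T ⟶ S) (g' : T' ⟶ S') (f' : T' ⟶ T),
        AlgebraicSpace.IsEtale g → IsPullback g' f' f g → Epi f' := by
  have key : ∀ ⦃T' T : AlgebraicSpace.{u}⦄ (g : T ⟶ S) (g' : T' ⟶ S') (f' : T' ⟶ T),
      AlgebraicSpace.IsEtale g → IsPullback g' f' f g → Epi f' := by
    intro T' T g g' f' ⟨U, α, hα, hα', hαg⟩ sq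
    refine ⟨fun {Z} a b h ↦ ?_⟩
    ext1
    refine hom_ext_of_submersive hdom hsub Z.property hα hα' hαg fun {X} s' x hx ↦ ?_
    -- The pair `(s', x)` factors through `T'`, where `a` and `b` agree.
    let X' : AlgebraicSpace.{u} := ⟨_, IsAlgebraicSpace.yoneda_obj X⟩
    let x' : X' ⟶ T := ObjectProperty.homMk x
    obtain ⟨l, -, hl'⟩ := sq.exists_lift (ObjectProperty.homMk s' : X' ⟶ S') x' (by
      ext1; exact hx)
    have hl : l.hom ≫ f'.hom = x := congrArg (fun k : X' ⟶ T ↦ k.hom) hl'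
    rw [← hl, Category.assoc, Category.assoc]
    exact congrArg (l.hom ≫ ·.hom) h
  -- `f` is its own base change along the identity, which is étale by any atlas of `S`.
  refine ⟨key (𝟙 S) (𝟙 S') f ?_ (IsPullback.of_id_fst), key⟩
  obtain ⟨U, α, hα, hα'⟩ := S.property.exists_atlas
  exact ⟨U, α, hα, hα', by simpa using hα⟩
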